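/- Let $\alpha$ be a finite ordinal. A polyadic-type algebra is an algebra $\langle A,+,-,c_i,d_{ij},p_{ij}\rangle_{i,j<\alpha}$ with $+$ binary, $-,c_i,p_{ij}$ unary and $d_{ij}$ nullary. $Pse_\alpha$ is the class of polyadic equality set algebras of dimension $\alpha$, that is, of the algebras $\langle A,\cup,-,C_i^U,D_{ij}^U,P_{ij}\rangle_{i,j<\alpha}$ in which $A$ is, for some set $U$, a family of subsets of $U^\alpha$ closed under union, complementation with respect to $U^\alpha$, the cylindrifications $C_i^U X=\{s\in U^\alpha:\ s_j=s'_j \text{ for all } j\ne i, \text{ for some } s'\in X\}$ and the transpositions $P_{ij}X=\{s\in U^\alpha:\ s_i=s'_j,\ s_j=s'_i \text{ and } s_l=s'_l \text{ for all } l\ne i,j, \text{ for some } s'\in X\}$, and containing the diagonals $D_{ij}^U=\{s\in U^\alpha:\ s_i=s_j\}$. An algebra is $n$-generated if it is generated by a set of at most $n$ of its elements. Theorem. For all $\alpha$ and $n$ with $3\le\alpha<\omega$ and $n<\omega$ there exists a polyadic-type algebra $\mathcal A$ with the following properties. (i) $\mathcal A$ is not isomorphic to a member of $Pse_\alpha$.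 (ii) Each $n$-generated subalgebra of $\mathcal A$ is isomorphic to a member of $Pse_\alpha$. (iii) The cylindrification-free reduct $\langle A,+,-,d_{ij},p_{ij}\rangle_{i,j<\alpha}$, the diagonal-free reduct $\langle A,+,-,c_i,p_{ij}\rangle_{i,j<\alpha}$ and the transposition-free reduct $\langle A,+,-,c_i,d_{ij}\rangle_{i,j<\alpha}$ of $\mathcal A$ are all isomorphic to subalgebras of the corresponding reducts of members of $Pse_\alpha$. -/

import Mathlib

universe u v

open scoped FirstOrder

/-- The operation symbols `+, -, c_i, d_ij, p_ij` (`i, j < α`) of polyadic-type algebras,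
indexed by their arity. -/
inductive PolyadicOp (α : ℕ) : ℕ → Type
  | join : PolyadicOp α 2
  | compl : PolyadicOp α 1
  | cyl (i : Fin α) : PolyadicOp α 1
  | diag (i j : Fin α) : PolyadicOp α 0
  | transp (i j : Fin α) : PolyadicOp α 1

namespace PolyadicOp

/-- The symbol is one of the cylindrifications `c_i`. -/
def IsCyl {α : ℕ} : ∀ {n : ℕ}, PolyadicOp α n → Prop
  | _, .cyl _ => True
  | _, _ => False

/-- The symbol is one of the diagonal constants `d_ij`. -/
def IsDiag {α : ℕ} : ∀ {n : ℕ}, PolyadicOp α n → Prop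
  | _, .diag _ _ => True
  | _, _ => False

/-- The symbol is one of the transposition operations `p_ij`. -/
def IsTransp {α : ℕ} : ∀ {n : ℕ}, PolyadicOp α n → Prop
  | _, .transp _ _ => True
  | _, _ => False

end PolyadicOp

/-- The algebraic similarity type of `α`-dimensional polyadic equality set algebras. A
polyadic-type algebra is a structure for this language. -/
def polyadicLanguage (α : ℕ) : FirstOrder.Language.{0, 0} :=
  ⟨PolyadicOp α, fun _ => Empty⟩

/-- The part of the polyadic similarity type that consists of the operation symbols in `K`. -/
def polyadicSublanguage (α : ℕ) (K : ∀ n, Set (PolyadicOp α n)) : FirstOrder.Language.{0, 0} :=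
  ⟨fun n => K n, fun _ => Empty⟩

/-- The inclusion of a part of the polyadic similarity type. -/
def polyadicSublanguageHom (α : ℕ) (K : ∀ n, Set (PolyadicOp α n)) :
    polyadicSublanguage α K →ᴸ polyadicLanguage α where
  onFunction _ f := f.1
  onRelation _ r := r

/-- The reduct of a polyadic-type algebra to the operations in `K`. -/
instance polyadicReduct (α : ℕ) (K : ∀ n, Set (PolyadicOp α n)) (A : Type u)
    [(polyadicLanguage α).Structure A] : (polyadicSublanguage α K).Structure A :=
  (polyadicSublanguageHom α K).reduct A

/-- The operations that remain in the cylindrification-free reduct. -/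
def cylFreeOps (α : ℕ) (n : ℕ) : Set (PolyadicOp α n) := {f | ¬ f.IsCyl}

/-- The operations that remain in the diagonal-free reduct. -/
def diagFreeOps (α : ℕ) (n : ℕ) : Set (PolyadicOp α n) := {f | ¬ f.IsDiag}

/-- The operations that remain in the transposition-free (cylindric) reduct. -/
def transpFreeOps (α : ℕ) (n : ℕ) : Set (PolyadicOp α n) := {f | ¬ f.IsTransp}

/-- Cylindrification `C_i^U X`: all `u` that agree with some `u' ∈ X` at all `j ≠ i`. -/
def setCyl {α : ℕ} {U : Type v} (i : Fin α) (X : Set (Fin α → U)) : Set (Fin α → U) :=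
  {s | ∃ s' ∈ X, ∀ j, j ≠ i → s j = s' j}

/-- Diagonal constant `D_ij^U`. -/
def setDiag {α : ℕ} (U : Type v) (i j : Fin α) : Set (Fin α → U) :=
  {s | s i = s j}

/-- Transposition `P_ij X`: all `u` obtained from some `u' ∈ X` by interchanging the
`i`-th and the `j`-th coordinates. -/
def setTransp {α : ℕ} {U : Type v} (i j : Fin α) (X : Set (Fin α → U)) : Set (Fin α → U) :=
  {s | ∃ s' ∈ X, s i = s' j ∧ s j = s' i ∧ ∀ l, l ≠ i → l ≠ j → s l = s' l}

/-- The polyadic equality set algebra of all subsets of `U^α`. -/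
instance fullSetAlgebra (α : ℕ) (U : Type v) :
    (polyadicLanguage α).Structure (Set (Fin α → U)) where
  funMap {n} (f : PolyadicOp α n) :=
    match n, f with
    | _, .join => fun x => x 0 ∪ x 1
    | _, .compl => fun x => (x 0)ᶜ
    | _, .cyl i => fun x => setCyl i (x 0)
    | _, .diag i j => fun _ => setDiag U i j
    | _, .transp i j => fun x => setTransp i j (x 0)
  RelMap r := Empty.elim r

/-- A member of `Pse_α` with base set `U`: a family of subsets of `U^α` that is closed under
all the operations (and contains the diagonals), with the restricted operations. -/
abbrev PolyadicSetAlgebra (α : ℕ) (U : Type v) : Type v :=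
  (polyadicLanguage α).Substructure (Set (Fin α → U))

/-- The polyadic-type algebra `A` is isomorphic to a member of `Pse_α` (with base set in the
universe `v`). -/
def IsoToPse (α : ℕ) (A : Type u) [(polyadicLanguage α).Structure A] : Prop :=
  ∃ (U : Type v) (S : PolyadicSetAlgebra α U), Nonempty (A ≃[polyadicLanguage α] S)

/-- The reduct of `A` to the operations in `K` is isomorphic to a subalgebra of the
corresponding reduct of a member of `Pse_α` (with base set in the universe `v`). -/
def ReductIsoToSubPse (α : ℕ) (K : ∀ n, Set (PolyadicOp α n)) (A : Type u)
    [(polyadicLanguage α).Structure A] : Prop :=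
  ∃ (U : Type v) (S : PolyadicSetAlgebra α U) (T : (polyadicSublanguage α K).Substructure S),
    Nonempty (A ≃[polyadicSublanguage α K] T)

/-- The subalgebra `S` is generated by a set of at most `n` of its elements. -/
def IsNGenerated {α : ℕ} (n : ℕ) {A : Type u} [(polyadicLanguage α).Structure A]
    (S : (polyadicLanguage α).Substructure A) : Prop :=
  ∃ X : Set A, X.encard ≤ n ∧ FirstOrder.Language.Substructure.closure (polyadicLanguage α) X = S

/-!
The elements of the algebra are families, indexed by a set `C` of colours, of sets of sequences of
vertices, bijective labellings of the vertices and tail points. They are invariant under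
permutations of the vertices and of the tail points, and they depend on the colour only at the
edges, the injective sequences of two vertices and otherwise tail points; a cylindrification forgets
the colour. To represent such an algebra is to colour the sequences so that changing a coordinate
can produce every colour.

With `|V|` odd and `|C| = |V| - 1` this is impossible: a labelling names the vertices injectively,
so a representation has at most `|V|` vertices, hence the edges of each of the `|C|` colours would
form a perfect matching of an odd number of vertices.

With half as many colours a symmetric Cayley colouring of the edges works, and `n` generators
distinguish only boundedly many colours, because in each colour a generator is determined by the
pairs of positions at which it contains edges. Without cylindrifications no colour has to be
attained, without diagonals the points can be blown up until an edge carries every colour, and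
without transpositions the colouring of the edges need not be symmetric, so that the Cayley
colouring by all of `C` is available.
-/

open FirstOrder.Language

section SetOperations

variable {α : ℕ} {U : Type*}

theorem mem_setCyl {i : Fin α} {X : Set (Fin α → U)} {s : Fin α → U} :
    s ∈ setCyl i X ↔ ∃ a, Function.update s i a ∈ X := by
  constructor
  · rintro ⟨s', hs', h⟩
    exact ⟨s' i, (Function.eq_update_iff.2 ⟨rfl, fun j hj => (h j hj).symm⟩) ▸ hs'⟩
  · rintro ⟨a, ha⟩
    exact ⟨_, ha, fun j hj => (Function.update_of_ne hj _ _).symm⟩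

theorem mem_setTransp {i j : Fin α} {X : Set (Fin α → U)} {s : Fin α → U} :
    s ∈ setTransp i j X ↔ s ∘ Equiv.swap i j ∈ X := by
  constructor
  · rintro ⟨s', hs', hi, hj, h⟩
    convert hs'
    funext l
    grind
  · exact fun hs => ⟨_, hs, by simp, by simp,
      fun l hi hj => by simp [Equiv.swap_apply_of_ne_of_ne hi hj]⟩

end SetOperations

/-- The value of an operation symbol in a polyadic-type algebra. -/
abbrev PolyadicOp.eval {α m : ℕ} {A : Type*} [(polyadicLanguage α).Structure A]
    (f : PolyadicOp α m) (x : Fin m → A) : A :=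
  Structure.funMap (L := polyadicLanguage α) f x

/-- The map `φ` between polyadic-type algebras commutes with the operation `f`. -/
def PreservesOp {α m : ℕ} {A B : Type*} [(polyadicLanguage α).Structure A]
    [(polyadicLanguage α).Structure B] (φ : A → B) (f : PolyadicOp α m) : Prop :=
  ∀ x, φ (f.eval x) = f.eval (φ ∘ x)

section Embeddings

variable {α : ℕ} {A B : Type*} [(polyadicLanguage α).Structure A]
  [(polyadicLanguage α).Structure B]

/-- An injective map that commutes with all operations, as an embedding of algebras. -/
def polyadicEmbedding (φ : A → B) (hφ : Function.Injective φ)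
    (hf : ∀ {m} (f : PolyadicOp α m), PreservesOp φ f) : A ↪[polyadicLanguage α] B where
  toFun := φ
  inj' := hφ
  map_fun' f := hf f
  map_rel' r := r.elim

theorem isoToPse_iff : IsoToPse.{_, v} α A ↔
    ∃ W : Type v, Nonempty (A ↪[polyadicLanguage α] Set (Fin α → W)) := by
  constructor
  · rintro ⟨W, S, ⟨e⟩⟩
    exact ⟨W, ⟨S.subtype.comp e.toEmbedding⟩⟩
  · rintro ⟨W, ⟨e⟩⟩
    exact ⟨W, e.toHom.range, ⟨e.equivRange⟩⟩

theorem IsoToPse.of_embedding (h : IsoToPse.{_, v} α B) (e : A ↪[polyadicLanguage α] B) :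
    IsoToPse.{_, v} α A := by
  obtain ⟨W, ⟨φ⟩⟩ := isoToPse_iff.1 h
  exact isoToPse_iff.2 ⟨W, ⟨φ.comp e⟩⟩

theorem reductIsoToSubPse_of_preservesOp {K : ∀ m, Set (PolyadicOp α m)} {W : Type v}
    (φ : A → Set (Fin α → W)) (hφ : Function.Injective φ)
    (hf : ∀ {m} (f : PolyadicOp α m), f ∈ K m → PreservesOp φ f) :
    ReductIsoToSubPse.{_, v} α K A := by
  let e : A ↪[polyadicSublanguage α K] (⊤ : PolyadicSetAlgebra α W) :=
    { toFun := fun a => ⟨φ a, trivial⟩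
      inj' := fun a b hab => hφ (congrArg Subtype.val hab)
      map_fun' := fun f x => Subtype.ext (hf f.1 f.2 x)
      map_rel' := fun r => r.elim }
  exact ⟨W, ⊤, e.toHom.range, ⟨e.equivRange⟩⟩

end Embeddings

/-- The families of subsets of `U^α` indexed by a type `C` of colours. As a polyadic-type algebra
this is the colourwise power of the full set algebra, except that cylindrifications forget the
colour. -/
def ColouredSets (α : ℕ) (U C : Type*) := C → Set (Fin α → U)

namespace ColouredSets

variable {α : ℕ} {U C : Type*}

instance : (polyadicLanguage α).Structure (ColouredSets α U C) where
  funMap {m} (f : PolyadicOp α m) :=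
    match m, f with
    | _, .join => fun x c => x 0 c ∪ x 1 c
    | _, .compl => fun x c => (x 0 c)ᶜ
    | _, .cyl i => fun x _ => setCyl i (⋃ c, x 0 c)
    | _, .diag i j => fun _ _ => setDiag U i j
    | _, .transp i j => fun x c => setTransp i j (x 0 c)
  RelMap r := r.elim

theorem mem_eval_cyl {i : Fin α} {x : Fin 1 → ColouredSets α U C} {c : C} {s : Fin α → U} :
    s ∈ (PolyadicOp.cyl i).eval x c ↔ ∃ a d, Function.update s i a ∈ x 0 d :=
  (mem_setCyl (X := ⋃ d, x 0 d)).trans (exists_congr fun _ => Set.mem_iUnion)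

theorem mem_eval_transp {i j : Fin α} {x : Fin 1 → ColouredSets α U C} {c : C}
    {s : Fin α → U} :
    s ∈ (PolyadicOp.transp i j).eval x c ↔ s ∘ Equiv.swap i j ∈ x 0 c :=
  mem_setTransp (X := x 0 c)

/-- The colour families that are invariant under `G` and depend on the colour only on `Q`. -/
def splitAlgebra (C G : Type*) [Group G] [MulAction G U] (Q : Set (Fin α → U))
    (hQ : ∀ (i j : Fin α) (s : Fin α → U), s ∘ Equiv.swap i j ∈ Q → s ∈ Q) :
    (polyadicLanguage α).Substructure (ColouredSets α U C) where
  carrier := {X | (∀ c (g : G) s, s ∈ X c → g • s ∈ X c) ∧ ∀ s ∉ Q, ∀ c c', s ∈ X c → s ∈ X c'}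
  fun_mem {m} f x hx := by
    match m, f with
    | _, .join =>
      exact ⟨fun c g s => Or.imp ((hx 0).1 c g s) ((hx 1).1 c g s),
        fun s hs c c' => Or.imp ((hx 0).2 s hs c c') ((hx 1).2 s hs c c')⟩
    | _, .compl =>
      refine ⟨fun c g s hs h => hs ?_, fun s hsQ c c' hs h => hs ((hx 0).2 s hsQ c' c h)⟩
      simpa only [inv_smul_smul] using (hx 0).1 c g⁻¹ _ h
    | _, .cyl i =>
      refine ⟨fun c g s hs => ?_, fun _ _ _ _ hs => hs⟩
      obtain ⟨s', hs', h⟩ := hs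
      obtain ⟨d, hd⟩ := Set.mem_iUnion.1 hs'
      exact ⟨g • s', Set.mem_iUnion.2 ⟨d, (hx 0).1 d g s' hd⟩,
        fun j hj => congrArg (g • ·) (h j hj)⟩
    | _, .diag i j =>
      exact ⟨fun c g s hs => congrArg (g • ·) hs, fun _ _ _ _ hs => hs⟩
    | _, .transp i j =>
      refine ⟨fun c g s hs => ?_, fun s hsQ c c' hs => ?_⟩
      · exact mem_setTransp.2 ((hx 0).1 c g _ (mem_setTransp.1 hs))
      · exact mem_setTransp.2 ((hx 0).2 _ (fun h => hsQ (hQ i j s h)) c c' (mem_setTransp.1 hs))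

section SplitAlgebra

variable {G : Type*} [Group G] [MulAction G U] {Q : Set (Fin α → U)}
  {hQ : ∀ (i j : Fin α) (s : Fin α → U), s ∘ Equiv.swap i j ∈ Q → s ∈ Q}

theorem mem_congr_of_mem_orbit {X : ColouredSets α U C} (hX : X ∈ splitAlgebra C G Q hQ) (c : C)
    {s s' : Fin α → U} (h : s' ∈ MulAction.orbit G s) : s' ∈ X c ↔ s ∈ X c := by
  obtain ⟨g, rfl⟩ := h
  exact ⟨fun h => by simpa only [inv_smul_smul] using hX.1 c g⁻¹ _ h, hX.1 c g s⟩

theorem mem_congr_of_notMem {X : ColouredSets α U C} (hX : X ∈ splitAlgebra C G Q hQ)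
    {s : Fin α → U} (hs : s ∉ Q) (c d : C) : s ∈ X c ↔ s ∈ X d :=
  ⟨hX.2 s hs c d, hX.2 s hs d c⟩

/-- Passing to the colours in the range of `ρ` embeds a subalgebra whose members only distinguish
those colours. -/
def relabelEmbedding {Γ : Type*} (S : (polyadicLanguage α).Substructure (splitAlgebra C G Q hQ))
    (ρ : Γ → C) (hρ : ∀ c, ∃ γ, ∀ X ∈ S, X.1 c = X.1 (ρ γ)) :
    S ↪[polyadicLanguage α] splitAlgebra Γ G Q hQ :=
  polyadicEmbedding (fun X => ⟨fun γ => X.1.1 (ρ γ), fun γ => X.1.2.1 (ρ γ),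
      fun s hs γ γ' => X.1.2.2 s hs (ρ γ) (ρ γ')⟩)
    (fun X Y h => by
      refine Subtype.ext (Subtype.ext (funext fun c => ?_))
      obtain ⟨γ, hγ⟩ := hρ c
      rw [hγ X X.2, hγ Y Y.2]
      exact congrFun (congrArg Subtype.val h) γ)
    (fun {m} f x => by
      refine Subtype.ext (funext fun γ => ?_)
      match m, f with
      | _, .join | _, .compl | _, .diag _ _ | _, .transp _ _ => rfl
      | _, .cyl i =>
        refine congrArg (setCyl i) (Set.Subset.antisymm (Set.iUnion_subset fun c => ?_)
          (Set.iUnion_subset fun γ => Set.subset_iUnion_of_subset (ρ γ) subset_rfl))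
        obtain ⟨γ, hγ⟩ := hρ c
        exact Set.subset_iUnion_of_subset γ (hγ (x 0).1 (x 0).2).subset)

end SplitAlgebra

/-- The colour families that do not distinguish the colours `c` and `c'`. -/
def agreeing (α : ℕ) (U : Type*) {C : Type*} (c c' : C) :
    (polyadicLanguage α).Substructure (ColouredSets α U C) where
  carrier := {X | X c = X c'}
  fun_mem {m} f x hx := by
    match m, f with
    | _, .join => exact congrArg₂ (· ∪ ·) (hx 0) (hx 1)
    | _, .compl => exact congrArg compl (hx 0)
    | _, .cyl _ | _, .diag _ _ => exact rfl
    | _, .transp i j => exact congrArg (setTransp i j) (hx 0)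

theorem eq_of_mem_closure {A : (polyadicLanguage α).Substructure (ColouredSets α U C)} {F : Set A}
    {c c' : C} (h : ∀ X ∈ F, X.1 c = X.1 c') {X : A}
    (hX : X ∈ Substructure.closure (polyadicLanguage α) F) : X.1 c = X.1 c' :=
  (Substructure.closure_le (S := (agreeing α U c c').comap A.subtype.toHom)).2 h hX

section Realization

variable {G : Type*} [Group G] [MulAction G U] {Q : Set (Fin α → U)}
  {hQ : ∀ (i j : Fin α) (s : Fin α → U), s ∘ Equiv.swap i j ∈ Q → s ∈ Q}
  {W : Type*}

/-- The set of sequences over `W` described by a colour family over `U`, when `W` lies over `U`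
by `h` and the sequences over `W` are coloured by `κ`. -/
def realize (h : W → U) (κ : (Fin α → W) → C) (X : ColouredSets α U C) : Set (Fin α → W) :=
  {w | h ∘ w ∈ X (κ w)}

/-- Changing the `i`-th entry of `w` gives it any colour, while its image under `h` stays in the
same orbit. -/
def IsRecolourable (G : Type*) [Group G] [MulAction G U] (h : W → U) (κ : (Fin α → W) → C)
    (w : Fin α → W) (i : Fin α) : Prop :=
  ∀ c, ∃ y, h ∘ Function.update w i y ∈ MulAction.orbit G (h ∘ w) ∧ κ (Function.update w i y) = c

variable {h : W → U} {κ : (Fin α → W) → C}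

theorem IsRecolourable.exists_realize {w : Fin α → W} {i : Fin α}
    (hw : h ∘ w ∈ Q → IsRecolourable G h κ w i) (c : C) :
    ∃ y, ∀ X ∈ splitAlgebra C G Q hQ,
      Function.update w i y ∈ realize h κ X ↔ h ∘ w ∈ X c := by
  by_cases hQw : h ∘ w ∈ Q
  · obtain ⟨y, hy, rfl⟩ := hw hQw c
    exact ⟨y, fun X hX => mem_congr_of_mem_orbit hX _ hy⟩
  · refine ⟨w i, fun X hX => ?_⟩
    rw [Function.update_eq_self]
    exact mem_congr_of_notMem hX hQw _ _

theorem realize_injOn (hh : Function.Surjective h)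
    (hκ : ∀ w, ∃ i, h ∘ w ∈ Q → IsRecolourable G h κ w i) :
    Set.InjOn (realize h κ) (splitAlgebra C G Q hQ : Set (ColouredSets α U C)) := by
  intro X hX Y hY hXY
  funext c
  ext s
  obtain ⟨w, rfl⟩ := hh.comp_left s
  obtain ⟨i, hi⟩ := hκ w
  obtain ⟨y, hy⟩ := IsRecolourable.exists_realize (hQ := hQ) hi c
  rw [← hy X hX, ← hy Y hY, hXY]

theorem preservesOp_realize_join :
    PreservesOp (fun X : splitAlgebra C G Q hQ => realize h κ X.1)
      (.join : PolyadicOp α _) :=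
  fun _ => rfl

theorem preservesOp_realize_compl :
    PreservesOp (fun X : splitAlgebra C G Q hQ => realize h κ X.1)
      (.compl : PolyadicOp α _) :=
  fun _ => rfl

theorem preservesOp_realize_diag (hh : Function.Injective h) (i j : Fin α) :
    PreservesOp (fun X : splitAlgebra C G Q hQ => realize h κ X.1) (.diag i j) :=
  fun _ => Set.ext fun _ => hh.eq_iff

theorem preservesOp_realize_transp (i j : Fin α)
    (hκ : ∀ w, h ∘ w ∈ Q → κ (w ∘ Equiv.swap i j) = κ w) :
    PreservesOp (fun X : splitAlgebra C G Q hQ => realize h κ X.1) (.transp i j) := by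
  refine fun x => Set.ext fun w => ?_
  change h ∘ w ∈ (PolyadicOp.transp i j).eval (fun l => (x l).1) (κ w) ↔
    w ∈ setTransp i j (realize h κ (x 0).1)
  rw [mem_eval_transp, mem_setTransp]
  change (h ∘ w) ∘ Equiv.swap i j ∈ (x 0).1 (κ w) ↔
    (h ∘ w) ∘ Equiv.swap i j ∈ (x 0).1 (κ (w ∘ Equiv.swap i j))
  by_cases hw : (h ∘ w) ∘ Equiv.swap i j ∈ Q
  · rw [hκ w (hQ i j _ hw)]
  · exact mem_congr_of_notMem (x 0).2 hw _ _

theorem preservesOp_realize_cyl (hh : Function.Surjective h) (i : Fin α)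
    (hκ : ∀ w, h ∘ w ∈ Q → IsRecolourable G h κ w i) :
    PreservesOp (fun X : splitAlgebra C G Q hQ => realize h κ X.1) (.cyl i) := by
  refine fun x => Set.ext fun w => ?_
  change h ∘ w ∈ (PolyadicOp.cyl i).eval (fun l => (x l).1) (κ w) ↔
    w ∈ setCyl i (realize h κ (x 0).1)
  rw [mem_eval_cyl, mem_setCyl]
  constructor
  · rintro ⟨a, c, hc⟩
    obtain ⟨a, rfl⟩ := hh a
    rw [← Function.comp_update] at hc
    obtain ⟨y, hy⟩ := IsRecolourable.exists_realize (hQ := hQ) (hκ (Function.update w i a)) c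
    rw [Function.update_idem] at hy
    exact ⟨y, (hy _ (x 0).2).2 hc⟩
  · rintro ⟨y, hy⟩
    exact ⟨h y, κ (Function.update w i y), by rwa [← Function.comp_update]⟩

end Realization

end ColouredSets

/-- The sorts of points of the base set. -/
inductive Kind
  | vertex
  | labelling
  | tail

/-- The base set of the counterexample: the vertices of a graph, the bijective labellings of the
vertices by themselves, and infinitely many tail points. -/
inductive Pt (V : Type) : Type
  | vertex (a : V)
  | labelling (t : Equiv.Perm V)
  | tail (n : ℕ)

namespace Pt

variable {V : Type}

/-- The sort of a point. -/
def kind : Pt V → Kind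
  | vertex _ => .vertex
  | labelling _ => .labelling
  | tail _ => .tail

theorem kind_eq_vertex {x : Pt V} : x.kind = .vertex ↔ ∃ a, x = vertex a := by
  cases x <;> simp [kind]

theorem kind_eq_labelling {x : Pt V} : x.kind = .labelling ↔ ∃ t, x = labelling t := by
  cases x <;> simp [kind]

theorem kind_eq_tail {x : Pt V} : x.kind = .tail ↔ ∃ n, x = tail n := by
  cases x <;> simp [kind]

instance : MulAction (Equiv.Perm V × Equiv.Perm ℕ) (Pt V) where
  smul g
    | vertex a => vertex (g.1 a)
    | labelling t => labelling (g.1 * t)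
    | tail n => tail (g.2 n)
  one_smul x := by cases x <;> rfl
  mul_smul g h x := by cases x <;> rfl

@[simp]
theorem kind_smul (g : Equiv.Perm V × Equiv.Perm ℕ) (x : Pt V) : (g • x).kind = x.kind := by
  cases x <;> rfl

theorem exists_kind_eq_vertex_ne [Nontrivial V] (x : Pt V) :
    ∃ y : Pt V, y.kind = .vertex ∧ y ≠ x := by
  obtain ⟨a, b, hab⟩ := exists_pair_ne V
  by_cases hx : vertex a = x
  · exact ⟨vertex b, rfl, fun h => hab (vertex.inj (hx.trans h.symm))⟩
  · exact ⟨vertex a, rfl, hx⟩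

theorem mem_orbit_of_injective {ι : Type*} [Finite V] [Finite ι] {s s' : ι → Pt V}
    (hs : Function.Injective s) (hs' : Function.Injective s')
    (hk : ∀ i, (s i).kind = (s' i).kind) (hl : ∀ i, (s i).kind ≠ .labelling) :
    s' ∈ MulAction.orbit (Equiv.Perm V × Equiv.Perm ℕ) s := by
  choose a ha using fun i : {i // (s i).kind = .vertex} => kind_eq_vertex.1 i.2
  choose a' ha' using fun i : {i // (s i).kind = .vertex} => kind_eq_vertex.1 (hk i ▸ i.2)
  choose n hn using fun i : {i // (s i).kind = .tail} => kind_eq_tail.1 i.2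
  choose n' hn' using fun i : {i // (s i).kind = .tail} => kind_eq_tail.1 (hk i ▸ i.2)
  obtain ⟨σ, hσ⟩ := Equiv.Perm.exists_extending_pair a a'
    (fun i j e => Subtype.ext (hs (by rw [ha, ha, e])))
    (fun i j e => Subtype.ext (hs' (by rw [ha', ha', e])))
  obtain ⟨τ, hτ⟩ := Equiv.Perm.exists_extending_pair n n'
    (fun i j e => Subtype.ext (hs (by rw [hn, hn, e])))
    (fun i j e => Subtype.ext (hs' (by rw [hn', hn', e])))
  refine ⟨(σ, τ), funext fun i => ?_⟩
  change (σ, τ) • s i = s' i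
  cases hi : (s i).kind with
  | vertex => rw [ha ⟨i, hi⟩, ha' ⟨i, hi⟩, ← hσ]; rfl
  | labelling => exact absurd hi (hl i)
  | tail => rw [hn ⟨i, hi⟩, hn' ⟨i, hi⟩, ← hτ]; rfl

end Pt

section Edges

variable {α : ℕ} {V : Type}

/-- The sequence `s` is an edge at the positions `p` and `q`: it is injective and has vertices
at `p` and `q` and tail points elsewhere. -/
structure IsEdge (p q : Fin α) (s : Fin α → Pt V) : Prop where
  ne : p ≠ q
  injective : Function.Injective s
  kind_eq : ∀ l, (s l).kind = if l = p ∨ l = q then .vertex else .tail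

namespace IsEdge

variable {p q : Fin α} {s s' : Fin α → Pt V}

theorem kind_left (h : IsEdge p q s) : (s p).kind = .vertex := by simp [h.kind_eq]

theorem kind_right (h : IsEdge p q s) : (s q).kind = .vertex := by simp [h.kind_eq]

theorem kind_of_ne (h : IsEdge p q s) {l : Fin α} (hp : l ≠ p) (hq : l ≠ q) :
    (s l).kind = .tail := by
  simp [h.kind_eq, hp, hq]

theorem symm (h : IsEdge p q s) : IsEdge q p s :=
  ⟨h.ne.symm, h.injective, fun l => by simp only [h.kind_eq, or_comm]⟩

theorem comp_perm (h : IsEdge p q s) (σ : Equiv.Perm (Fin α)) :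
    IsEdge (σ.symm p) (σ.symm q) (s ∘ σ) :=
  ⟨σ.symm.injective.ne h.ne, h.injective.comp σ.injective, fun l => by
    simp [h.kind_eq, Equiv.eq_symm_apply]⟩

theorem comp_swap (h : IsEdge p q s) : IsEdge p q (s ∘ Equiv.swap p q) := by
  simpa using (h.comp_perm (Equiv.swap p q)).symm

theorem smul (h : IsEdge p q s) (g : Equiv.Perm V × Equiv.Perm ℕ) : IsEdge p q (g • s) :=
  ⟨h.ne, (MulAction.injective g).comp h.injective, fun l => by simp [h.kind_eq]⟩

theorem update (h : IsEdge p q s) {i : Fin α} {x : Pt V} (hx : x.kind = (s i).kind)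
    (hne : ∀ l, l ≠ i → s l ≠ x) : IsEdge p q (Function.update s i x) := by
  refine ⟨h.ne, fun l m => ?_, fun l => ?_⟩
  · have := @h.injective l m
    grind
  · have := h.kind_eq l
    grind

theorem ne_of_kind_eq_vertex (h : IsEdge p q s) {x : Pt V} (hx : x.kind = .vertex)
    (hq : s q ≠ x) (l : Fin α) (hl : l ≠ p) : s l ≠ x := by
  have := h.kind_eq l
  grind

theorem mem_orbit [Finite V] (h : IsEdge p q s) (h' : IsEdge p q s') :
    s' ∈ MulAction.orbit (Equiv.Perm V × Equiv.Perm ℕ) s :=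
  Pt.mem_orbit_of_injective h.injective h'.injective (fun l => by rw [h.kind_eq, h'.kind_eq])
    (fun l => by rw [h.kind_eq]; split_ifs <;> simp)

theorem exists_update_right [Nontrivial V] {x y : Pt V} (hp : (s p).kind = .vertex)
    (h : IsEdge p q (Function.update (Function.update s p x) q y)) :
    ∃ z, IsEdge p q (Function.update s q z) := by
  obtain ⟨z, hz, hne⟩ := Pt.exists_kind_eq_vertex_ne (s p)
  refine ⟨z, h.ne, fun l m => ?_, fun l => ?_⟩
  · have := h.ne
    have := @h.injective l m
    have := h.kind_eq l
    have := h.kind_eq m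
    grind
  · have := h.kind_eq l
    have := h.ne
    grind

end IsEdge

theorem exists_isEdge [Nontrivial V] {p q : Fin α} (hpq : p ≠ q) :
    ∃ s : Fin α → Pt V, IsEdge p q s := by
  obtain ⟨a, b, hab⟩ := exists_pair_ne V
  refine ⟨fun l => if l = p then .vertex a else if l = q then .vertex b else .tail l, hpq,
    fun l m => ?_, fun l => ?_⟩ <;> grind [Pt.kind]

/-- The sequences that are edges at some pair of positions. -/
def edges (α : ℕ) (V : Type) : Set (Fin α → Pt V) := {s | ∃ p q, IsEdge p q s}

theorem mem_edges_of_comp_swap (i j : Fin α) (s : Fin α → Pt V)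
    (h : s ∘ Equiv.swap i j ∈ edges α V) : s ∈ edges α V := by
  obtain ⟨p, q, h⟩ := h
  have hs : (s ∘ Equiv.swap i j) ∘ Equiv.swap i j = s := by
    funext l
    simp
  exact ⟨_, _, hs ▸ h.comp_perm (Equiv.swap i j)⟩

theorem exists_lt_of_mem_edges {s : Fin α → Pt V} (h : s ∈ edges α V) :
    ∃ p q, p < q ∧ IsEdge p q s := by
  obtain ⟨p, q, h⟩ := h
  obtain hpq | hpq := h.ne.lt_or_gt
  exacts [⟨p, q, hpq, h⟩, ⟨q, p, hpq, h.symm⟩]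

/-- The counterexample: the colour families over the points that are invariant under permutations
of the vertices and of the tail points and depend on the colour only at edges. -/
abbrev edgeAlgebra (α : ℕ) (V : Type) (C : Type*) :
    (polyadicLanguage α).Substructure (ColouredSets α (Pt V) C) :=
  ColouredSets.splitAlgebra C (Equiv.Perm V × Equiv.Perm ℕ) (edges α V) mem_edges_of_comp_swap

end Edges

section Colouring

variable {α : ℕ} {V : Type} {B C : Type*} [AddCommGroup C]

/-- The colour that a pair of points contributes to the colour of a sequence. -/
def edgeColour (ε : V × B → V × B → C) : Pt V × B → Pt V × B → C
  | (.vertex a, x), (.vertex b, y) => ε (a, x) (b, y)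
  | _, _ => 0

/-- The colour that a single point contributes to the colour of a sequence. -/
def tailColour (τ : ℕ → C) : Pt V → C
  | .tail n => τ n
  | _ => 0

/-- The colour of a sequence, obtained from a colouring `ε` of the pairs of vertices and a
colouring `τ` of the tail points. The vertices are blown up by a type `B`. -/
def colouring (ε : V × B → V × B → C) (τ : ℕ → C) (w : Fin α → Pt V × B) : C :=
  ∑ ij : Fin α × Fin α with ij.1 < ij.2, edgeColour ε (w ij.1) (w ij.2) +
    ∑ i, tailColour τ (w i).1

variable {ε : V × B → V × B → C} {τ : ℕ → C}

theorem edgeColour_eq_zero {x y : Pt V × B} (h : x.1.kind = .tail ∨ y.1.kind = .tail) :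
    edgeColour ε x y = 0 := by
  obtain ⟨_ | _ | _, _⟩ := x <;> obtain ⟨_ | _ | _, _⟩ := y <;>
    simp_all [edgeColour, Pt.kind]

theorem edgeColour_comm (hε : ∀ x y, ε x y = ε y x) (x y : Pt V × B) :
    edgeColour ε x y = edgeColour ε y x := by
  obtain ⟨_ | _ | _, _⟩ := x <;> obtain ⟨_ | _ | _, _⟩ := y <;> simp [edgeColour, hε]

namespace IsEdge

variable {p q : Fin α} {w : Fin α → Pt V × B}

theorem colouring_eq (h : IsEdge p q (Prod.fst ∘ w)) (hpq : p < q) :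
    colouring ε τ w = edgeColour ε (w p) (w q) + ∑ i, tailColour τ (w i).1 := by
  refine congrArg (· + _) (Finset.sum_eq_single_of_mem (p, q) (by simpa) fun ij hij hne => ?_)
  have hlt := (Finset.mem_filter.1 hij).2
  refine edgeColour_eq_zero ?_
  have hi := h.kind_eq ij.1
  have hj := h.kind_eq ij.2
  grind

theorem colouring_eq_of_comm (hε : ∀ x y, ε x y = ε y x) (h : IsEdge p q (Prod.fst ∘ w)) :
    colouring ε τ w = edgeColour ε (w p) (w q) + ∑ i, tailColour τ (w i).1 := by
  obtain hpq | hqp := h.ne.lt_or_gt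
  · exact h.colouring_eq hpq
  · rw [h.symm.colouring_eq hqp, edgeColour_comm hε]

theorem colouring_comp_perm (hε : ∀ x y, ε x y = ε y x) (h : IsEdge p q (Prod.fst ∘ w))
    (σ : Equiv.Perm (Fin α)) : colouring ε τ (w ∘ σ) = colouring ε τ w := by
  rw [h.colouring_eq_of_comm hε, (h.comp_perm σ).colouring_eq_of_comm (w := w ∘ σ) hε]
  simp only [Function.comp_apply, Equiv.apply_symm_apply]
  rw [Equiv.sum_comp σ fun i => tailColour τ (w i).1]

theorem colouring_update {i : Fin α} {y : Pt V × B}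
    (h : IsEdge p q (Prod.fst ∘ Function.update w i y)) (hpq : p < q) :
    colouring ε τ (Function.update w i y) =
      edgeColour ε (Function.update w i y p) (Function.update w i y q) +
        (tailColour τ y.1 + ∑ l ∈ Finset.univ \ {i}, tailColour τ (w l).1) := by
  rw [h.colouring_eq hpq, ← Finset.sum_update_of_mem (Finset.mem_univ i)]
  exact congrArg _ (Finset.sum_congr rfl fun l _ =>
    congrFun (Function.comp_update (fun x : Pt V × B => tailColour τ x.1) w i y) l)

end IsEdge

/-- Every vertex is joined to other vertices by pairs of every colour. -/
def SeesAllColours (ε : V × B → V × B → C) : Prop :=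
  ∀ x c, ∃ y, y.1 ≠ x.1 ∧ ε x y = c

/-- The sequence `w` can be given any colour by changing its `i`-th entry, up to permutations of
the vertices and of the tail points. -/
abbrev IsEdgeRecolourable (ε : V × B → V × B → C) (τ : ℕ → C) (w : Fin α → Pt V × B)
    (i : Fin α) : Prop :=
  ColouredSets.IsRecolourable (Equiv.Perm V × Equiv.Perm ℕ) Prod.fst (colouring ε τ) w i

namespace IsEdge

variable {p q : Fin α} {w : Fin α → Pt V × B} [Finite V]

theorem isRecolourable (h : IsEdge p q (Prod.fst ∘ w)) (hpq : p < q) {i : Fin α}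
    (hi : ∀ c, ∃ y : Pt V × B, y.1.kind = (w i).1.kind ∧ (∀ l, l ≠ i → (w l).1 ≠ y.1) ∧
      edgeColour ε (Function.update w i y p) (Function.update w i y q) + tailColour τ y.1 = c) :
    IsEdgeRecolourable ε τ w i := by
  intro c
  obtain ⟨y, hk, hne, hy⟩ := hi (c - ∑ l ∈ Finset.univ \ {i}, tailColour τ (w l).1)
  have hw : IsEdge p q (Prod.fst ∘ Function.update w i y) :=
    Function.comp_update Prod.fst w i y ▸ h.update hk hne
  exact ⟨y, h.mem_orbit hw, by rw [hw.colouring_update hpq, ← add_assoc, hy, sub_add_cancel]⟩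

theorem isRecolourable_of_ne (h : IsEdge p q (Prod.fst ∘ w)) (hpq : p < q)
    (hτ : ∀ c, (τ ⁻¹' {c}).Infinite) {i : Fin α} (hp : i ≠ p) (hq : i ≠ q) :
    IsEdgeRecolourable ε τ w i := by
  refine h.isRecolourable hpq fun c => ?_
  have hfin : {n | Pt.tail n ∈ Set.range (Prod.fst ∘ w)}.Finite :=
    (Set.finite_range _).preimage fun _ _ _ _ => Pt.tail.inj
  obtain ⟨n, hn, hnw⟩ := ((hτ (c - edgeColour ε (w p) (w q))).sdiff hfin).nonempty
  refine ⟨(.tail n, (w i).2), (h.kind_of_ne hp hq).symm, fun l _ hl => hnw ⟨l, hl⟩, ?_⟩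
  rw [Function.update_of_ne hp.symm, Function.update_of_ne hq.symm]
  exact (congrArg _ hn).trans (add_sub_cancel _ _)

theorem isRecolourable_left (h : IsEdge p q (Prod.fst ∘ w)) (hpq : p < q)
    (hε : SeesAllColours (flip ε)) : IsEdgeRecolourable ε τ w p := by
  refine h.isRecolourable hpq fun c => ?_
  obtain ⟨b, hb⟩ := Pt.kind_eq_vertex.1 h.kind_right
  obtain ⟨⟨a, x⟩, hab, hx⟩ := hε (b, (w q).2) c
  refine ⟨(.vertex a, x), h.kind_left.symm, ?_, ?_⟩
  · exact h.ne_of_kind_eq_vertex rfl fun e => hab (Pt.vertex.inj (hb.symm.trans e)).symm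
  · rw [Function.update_self, Function.update_of_ne h.ne.symm, ← hx,
      show w q = (.vertex b, (w q).2) from Prod.ext hb rfl]
    exact add_zero _

theorem isRecolourable_right (h : IsEdge p q (Prod.fst ∘ w)) (hpq : p < q)
    (hε : SeesAllColours ε) : IsEdgeRecolourable ε τ w q := by
  refine h.isRecolourable hpq fun c => ?_
  obtain ⟨a, ha⟩ := Pt.kind_eq_vertex.1 h.kind_left
  obtain ⟨⟨b, x⟩, hab, hx⟩ := hε (a, (w p).2) c
  refine ⟨(.vertex b, x), h.kind_right.symm, ?_, ?_⟩
  · exact h.symm.ne_of_kind_eq_vertex rfl fun e => hab (Pt.vertex.inj (ha.symm.trans e)).symm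
  · rw [Function.update_self, Function.update_of_ne h.ne, ← hx,
      show w p = (.vertex a, (w p).2) from Prod.ext ha rfl]
    exact add_zero _

end IsEdge

theorem isRecolourable_of_mem_edges [Finite V] {w : Fin α → Pt V × B}
    (hw : Prod.fst ∘ w ∈ edges α V) (hτ : ∀ c, (τ ⁻¹' {c}).Infinite)
    (hε : SeesAllColours ε) (hε' : SeesAllColours (flip ε)) (i : Fin α) :
    IsEdgeRecolourable ε τ w i := by
  obtain ⟨p, q, hpq, h⟩ := exists_lt_of_mem_edges hw
  by_cases hp : i = p
  · exact hp ▸ h.isRecolourable_left hpq hε'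
  by_cases hq : i = q
  · exact hq ▸ h.isRecolourable_right hpq hε
  exact h.isRecolourable_of_ne hpq hτ hp hq

theorem exists_isRecolourable [Finite V] (hα : 3 ≤ α) (hτ : ∀ c, (τ ⁻¹' {c}).Infinite)
    (w : Fin α → Pt V × B) :
    ∃ i, Prod.fst ∘ w ∈ edges α V → IsEdgeRecolourable ε τ w i := by
  by_cases hw : Prod.fst ∘ w ∈ edges α V
  · obtain ⟨p, q, hpq, h⟩ := exists_lt_of_mem_edges hw
    obtain ⟨i, hp, hq⟩ := ENat.exists_ne_ne_of_three_le (by simpa using mod_cast hα) p q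
    exact ⟨i, fun _ => h.isRecolourable_of_ne hpq hτ hp hq⟩
  · exact ⟨⟨0, by lia⟩, fun h => absurd h hw⟩

end Colouring

section CayleyColour

variable {V : Type} {B C : Type*} [AddGroup V] {f : V → C}

/-- The Cayley colouring of the pairs of vertices: a pair is coloured by its difference. -/
def cayleyColour (B : Type*) (f : V → C) (x y : V × B) : C := f (y.1 - x.1)

theorem seesAllColours_cayleyColour (hf : ∀ c, ∃ d ≠ 0, f d = c) :
    SeesAllColours (cayleyColour B f) := by
  rintro ⟨a, b⟩ c
  obtain ⟨d, hd, rfl⟩ := hf c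
  exact ⟨(d + a, b), by simpa, by simp [cayleyColour]⟩

theorem seesAllColours_flip_cayleyColour (hf : ∀ c, ∃ d ≠ 0, f d = c) :
    SeesAllColours (flip (cayleyColour B f)) := by
  rintro ⟨a, b⟩ c
  obtain ⟨d, hd, rfl⟩ := hf c
  exact ⟨(-d + a, b), by simpa, by simp [cayleyColour, flip]⟩

theorem cayleyColour_comm (hf : ∀ d, f (-d) = f d) (x y : V × B) :
    cayleyColour B f x y = cayleyColour B f y x := by
  rw [cayleyColour, ← hf, neg_sub, cayleyColour]

end CayleyColour

theorem exists_map_onto_ne_zero_of_card_lt (V C : Type*) [Fintype V] [Zero V] [Fintype C]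
    [Nonempty C] (h : Fintype.card C < Fintype.card V) :
    ∃ f : V → C, ∀ c, ∃ d ≠ 0, f d = c := by
  classical
  obtain ⟨g⟩ := Function.Embedding.nonempty_of_card_le (α := Option C) (β := V)
    (by rwa [Fintype.card_option])
  let e : Option C ↪ V := g.trans (Equiv.swap (g none) 0).toEmbedding
  have he : e none = 0 := Equiv.swap_apply_left _ _
  exact ⟨Function.invFun (e ∘ some), fun c => ⟨e (some c), he ▸ e.injective.ne (by simp),
    Function.leftInverse_invFun (e.injective.comp (Option.some_injective C)) c⟩⟩

theorem exists_infinite_fibers (C : Type*) [Countable C] [Nonempty C] :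
    ∃ τ : ℕ → C, ∀ c, (τ ⁻¹' {c}).Infinite := by
  obtain ⟨e⟩ := nonempty_denumerable (ℕ × C)
  refine ⟨fun n => ((Denumerable.eqv (ℕ × C)).symm n).2, fun c => ?_⟩
  exact Set.infinite_of_injective_forall_mem (f := fun n => Denumerable.eqv (ℕ × C) (n, c))
    (fun m n h => congrArg Prod.fst ((Equiv.injective _) h)) fun n => by simp

section Representations

variable {α : ℕ} {V : Type} {C : Type*} [AddCommGroup C]

section Representation

variable {B : Type*} {ε : V × B → V × B → C} {τ : ℕ → C}

/-- The set of sequences over the blown-up points that a member of the edge algebra describes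
under the colouring given by `ε` and `τ`. -/
def representation (α : ℕ) (ε : V × B → V × B → C) (τ : ℕ → C)
    (X : edgeAlgebra α V C) : Set (Fin α → Pt V × B) :=
  ColouredSets.realize Prod.fst (colouring ε τ) X.1

theorem representation_injective [Finite V] [Nonempty B] (hα : 3 ≤ α)
    (hτ : ∀ c, (τ ⁻¹' {c}).Infinite) :
    Function.Injective (representation α ε τ) := fun X Y h =>
  Subtype.ext (ColouredSets.realize_injOn Prod.fst_surjective (exists_isRecolourable hα hτ)
    X.2 Y.2 h)

theorem preservesOp_representation_join :
    PreservesOp (representation α ε τ) (.join : PolyadicOp α _) :=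
  ColouredSets.preservesOp_realize_join

theorem preservesOp_representation_compl :
    PreservesOp (representation α ε τ) (.compl : PolyadicOp α _) :=
  ColouredSets.preservesOp_realize_compl

theorem preservesOp_representation_diag [Subsingleton B] (i j : Fin α) :
    PreservesOp (representation α ε τ) (.diag i j) :=
  ColouredSets.preservesOp_realize_diag
    (fun _ _ h => Prod.ext h (Subsingleton.elim _ _)) i j

theorem preservesOp_representation_transp (hε : ∀ x y, ε x y = ε y x) (i j : Fin α) :
    PreservesOp (representation α ε τ) (.transp i j) :=
  ColouredSets.preservesOp_realize_transp i j fun _ ⟨_, _, h⟩ =>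
    h.colouring_comp_perm hε (Equiv.swap i j)

theorem preservesOp_representation_cyl [Finite V] [Nonempty B] (hτ : ∀ c, (τ ⁻¹' {c}).Infinite)
    (hε : SeesAllColours ε) (hε' : SeesAllColours (flip ε)) (i : Fin α) :
    PreservesOp (representation α ε τ) (.cyl i) :=
  ColouredSets.preservesOp_realize_cyl Prod.fst_surjective i fun _ hw =>
    isRecolourable_of_mem_edges hw hτ hε hε' i

end Representation

theorem cylFreeReduct_edgeAlgebra [Finite V] [Countable C] (hα : 3 ≤ α) :
    ReductIsoToSubPse.{_, v} α (cylFreeOps α) (edgeAlgebra α V C) := by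
  obtain ⟨τ, hτ⟩ := exists_infinite_fibers C
  refine reductIsoToSubPse_of_preservesOp
    (representation α (B := PUnit.{v + 1}) (fun _ _ => 0) τ) (representation_injective hα hτ) ?_
  rintro _ (_ | _ | i | ⟨i, j⟩ | ⟨i, j⟩) hf
  · exact preservesOp_representation_join
  · exact preservesOp_representation_compl
  · exact absurd trivial hf
  · exact preservesOp_representation_diag i j
  · exact preservesOp_representation_transp (fun _ _ => rfl) i j

-- Without diagonals the points may be blown up, which lets an edge carry every colour.
theorem diagFreeReduct_edgeAlgebra [Finite V] [Nontrivial V] [Countable C] (hα : 3 ≤ α) :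
    ReductIsoToSubPse.{_, v} α (diagFreeOps α) (edgeAlgebra α V C) := by
  obtain ⟨τ, hτ⟩ := exists_infinite_fibers C
  let ε (x y : V × ULift.{v} ℕ) : C := τ x.2.down + τ y.2.down
  have hcomm : ∀ x y, ε x y = ε y x := fun x y => add_comm _ _
  have hε : SeesAllColours ε := fun x c => by
    obtain ⟨a, ha⟩ := exists_ne x.1
    obtain ⟨n, hn⟩ := (hτ (c - τ x.2.down)).nonempty
    exact ⟨(a, ⟨n⟩), ha, (congrArg _ hn).trans (add_sub_cancel _ _)⟩
  have hε' : SeesAllColours (flip ε) := by rwa [show flip ε = ε from funext₂ fun x y => hcomm y x]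
  refine reductIsoToSubPse_of_preservesOp (representation α ε τ) (representation_injective hα hτ) ?_
  rintro _ (_ | _ | i | ⟨i, j⟩ | ⟨i, j⟩) hf
  · exact preservesOp_representation_join
  · exact preservesOp_representation_compl
  · exact preservesOp_representation_cyl hτ hε hε' i
  · exact absurd trivial hf
  · exact preservesOp_representation_transp hcomm i j

section Cayley

variable [AddGroup V] {f : V → C}

theorem transpFreeReduct_edgeAlgebra [Finite V] [Countable C] (hα : 3 ≤ α)
    (hf : ∀ c, ∃ d ≠ 0, f d = c) :
    ReductIsoToSubPse.{_, v} α (transpFreeOps α) (edgeAlgebra α V C) := by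
  obtain ⟨τ, hτ⟩ := exists_infinite_fibers C
  refine reductIsoToSubPse_of_preservesOp (representation α (cayleyColour PUnit.{v + 1} f) τ)
    (representation_injective hα hτ) ?_
  rintro _ (_ | _ | i | ⟨i, j⟩ | ⟨i, j⟩) h
  · exact preservesOp_representation_join
  · exact preservesOp_representation_compl
  · exact preservesOp_representation_cyl hτ (seesAllColours_cayleyColour hf)
      (seesAllColours_flip_cayleyColour hf) i
  · exact preservesOp_representation_diag i j
  · exact absurd trivial h

theorem isoToPse_edgeAlgebra [Finite V] [Countable C] (hα : 3 ≤ α)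
    (hf : ∀ c, ∃ d ≠ 0, f d = c) (hneg : ∀ d, f (-d) = f d) :
    IsoToPse.{_, v} α (edgeAlgebra α V C) := by
  obtain ⟨τ, hτ⟩ := exists_infinite_fibers C
  refine isoToPse_iff.2 ⟨_, ⟨polyadicEmbedding
    (representation α (cayleyColour PUnit.{v + 1} f) τ) (representation_injective hα hτ) ?_⟩⟩
  rintro _ (_ | _ | i | ⟨i, j⟩ | ⟨i, j⟩)
  · exact preservesOp_representation_join
  · exact preservesOp_representation_compl
  · exact preservesOp_representation_cyl hτ (seesAllColours_cayleyColour hf)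
      (seesAllColours_flip_cayleyColour hf) i
  · exact preservesOp_representation_diag i j
  · exact preservesOp_representation_transp (cayleyColour_comm hneg) i j

end Cayley

end Representations

theorem exists_comp_eq_of_card_le {C D Γ : Type*} [Nonempty C] [Finite D] [Finite Γ]
    (π : C → D) (h : Nat.card D ≤ Nat.card Γ) : ∃ ρ : Γ → C, ∀ c, ∃ γ, π (ρ γ) = π c := by
  have := Fintype.ofFinite D
  have := Fintype.ofFinite Γ
  rw [Nat.card_eq_fintype_card, Nat.card_eq_fintype_card] at h
  obtain ⟨e⟩ := Function.Embedding.nonempty_of_card_le h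
  have : Nonempty D := .map π inferInstance
  refine ⟨fun γ => Function.invFun π (Function.invFun e γ), fun c => ⟨e (π c), ?_⟩⟩
  exact (congrArg (π <| Function.invFun π ·) (Function.leftInverse_invFun e.injective (π c))).trans
    (Function.invFun_eq ⟨c, rfl⟩)

section Generators

variable {α : ℕ} {V : Type} [Finite V]

/-- The pairs of positions at which a set of sequences contains an edge. -/
def edgePositions (Y : Set (Fin α → Pt V)) : Set (Fin α × Fin α) :=
  {pq | ∃ s ∈ Y, IsEdge pq.1 pq.2 s}

variable {C : Type*}

theorem subset_of_edgePositions_subset {X : ColouredSets α (Pt V) C} (hX : X ∈ edgeAlgebra α V C)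
    {c c' : C} (h : edgePositions (X c) ⊆ edgePositions (X c')) : X c ⊆ X c' := by
  intro s hs
  by_cases hsQ : s ∈ edges α V
  · obtain ⟨p, q, he⟩ := hsQ
    obtain ⟨s', hs', he'⟩ := h (show (p, q) ∈ edgePositions (X c) from ⟨s, hs, he⟩)
    exact (ColouredSets.mem_congr_of_mem_orbit hX c' (he'.mem_orbit he)).2 hs'
  · exact (ColouredSets.mem_congr_of_notMem hX hsQ c c').1 hs

theorem eq_of_edgePositions_eq {X : ColouredSets α (Pt V) C} (hX : X ∈ edgeAlgebra α V C)
    {c c' : C} (h : edgePositions (X c) = edgePositions (X c')) : X c = X c' :=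
  (subset_of_edgePositions_subset hX h.subset).antisymm
    (subset_of_edgePositions_subset hX h.superset)

theorem IsNGenerated.exists_transversal [Nonempty C] {n : ℕ}
    {S : (polyadicLanguage α).Substructure (edgeAlgebra α V C)} (hS : IsNGenerated n S)
    (Γ : Type*) [Finite Γ] (hΓ : 2 ^ (α * α * n) ≤ Nat.card Γ) :
    ∃ ρ : Γ → C, ∀ c, ∃ γ, ∀ X ∈ S, X.1 c = X.1 (ρ γ) := by
  obtain ⟨X, hn, rfl⟩ := hS
  have : Finite X := Set.finite_of_encard_le_coe hn
  have hcard : Nat.card (X → Set (Fin α × Fin α)) ≤ Nat.card Γ := by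
    have hX : Nat.card X ≤ n := by
      rwa [Nat.card_coe_set_eq, ← Nat.cast_le (α := ℕ∞), X.toFinite.cast_ncard_eq]
    refine le_trans ?_ hΓ
    rw [Nat.card_fun, Nat.card_eq_fintype_card (α := Set _), Fintype.card_set, Fintype.card_prod,
      Fintype.card_fin, ← pow_mul]
    gcongr
    exact one_le_two
  obtain ⟨ρ, hρ⟩ := exists_comp_eq_of_card_le (fun c (Y : X) => edgePositions (Y.1.1 c)) hcard
  refine ⟨ρ, fun c => (hρ c).imp fun γ hγ Y hY =>
    ColouredSets.eq_of_mem_closure (fun Z hZ => ?_) hY⟩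
  exact (eq_of_edgePositions_eq Z.2 (congrFun hγ ⟨Z, hZ⟩)).symm

theorem IsNGenerated.isoToPse [Nonempty C] {n : ℕ}
    {S : (polyadicLanguage α).Substructure (edgeAlgebra α V C)} (hS : IsNGenerated n S)
    {Γ : Type*} [Finite Γ] (hΓ : 2 ^ (α * α * n) ≤ Nat.card Γ)
    (h : IsoToPse.{_, v} α (edgeAlgebra α V Γ)) : IsoToPse.{_, v} α S := by
  obtain ⟨ρ, hρ⟩ := hS.exists_transversal Γ hΓ
  exact h.of_embedding (ColouredSets.relabelEmbedding S ρ hρ)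

end Generators

section Factorization

variable {N C : Type*} [Fintype N] [Fintype C] {G : C → SimpleGraph N}

theorem existsUnique_adj_of_card_le (hG : ∀ c c' x y, (G c).Adj x y → (G c').Adj x y → c = c')
    (hadj : ∀ c x, ∃ y, (G c).Adj x y) (hcard : Fintype.card N ≤ Fintype.card C + 1) (c : C)
    (x : N) : Fintype.card N = Fintype.card C + 1 ∧ ∃! y, (G c).Adj x y := by
  choose y hy using fun c => hadj c x
  let e : Option C → N := fun o => o.elim x y
  have he : Function.Injective e
    | none, none, _ => rfl
    | none, some c, h => absurd h (hy c).ne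
    | some c, none, h => absurd h (hy c).ne'
    | some c, some c', h =>
      congrArg some (hG c c' x (y c) (hy c) ((show y c = y c' from h) ▸ hy c'))
  have hN : Fintype.card N = Fintype.card C + 1 :=
    hcard.antisymm (Fintype.card_option (α := C) ▸ Fintype.card_le_of_injective e he)
  have hsurj : Function.Surjective e :=
    ((Fintype.bijective_iff_injective_and_card e).2 ⟨he, by rw [hN, Fintype.card_option]⟩).2
  refine ⟨hN, y c, hy c, fun z hz => ?_⟩
  obtain ⟨_ | c', rfl⟩ := hsurj z
  · exact absurd rfl hz.ne
  · rw [hG c c' x (y c') hz (hy c')]; rfl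

-- Each of the graphs is a perfect matching of the `card C + 1` vertices.
theorem odd_card_of_factorization [Nonempty N] [Nonempty C]
    (hG : ∀ c c' x y, (G c).Adj x y → (G c').Adj x y → c = c')
    (hadj : ∀ c x, ∃ y, (G c).Adj x y) (hcard : Fintype.card N ≤ Fintype.card C + 1) :
    Odd (Fintype.card C) := by
  classical
  obtain ⟨c⟩ := ‹Nonempty C›
  obtain ⟨x⟩ := ‹Nonempty N›
  have hdeg : ∀ x, (G c).degree x = 1 := fun x =>
    SimpleGraph.degree_eq_one_iff_existsUnique_adj.2
      (existsUnique_adj_of_card_le hG hadj hcard c x).2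
  have hsum := (G c).sum_degrees_eq_twice_card_edges
  simp only [hdeg, Finset.sum_const, Finset.card_univ, smul_eq_mul, mul_one] at hsum
  have hN := (existsUnique_adj_of_card_le hG hadj hcard c x).1
  exact ⟨(G c).edgeFinset.card - 1, by lia⟩

end Factorization

section Homomorphisms

variable {α : ℕ} {A W : Type*} [(polyadicLanguage α).Structure A]
  (φ : A →[polyadicLanguage α] Set (Fin α → W)) {w w' : Fin α → W}

theorem map_eval {m : ℕ} (f : PolyadicOp α m) (x : Fin m → A) : φ (f.eval x) = f.eval (φ ∘ x) :=
  φ.map_fun f x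

theorem mem_map_diag {i j : Fin α} {x : Fin 0 → A} :
    w ∈ φ ((PolyadicOp.diag i j).eval x) ↔ w i = w j := by
  rw [map_eval]; rfl

theorem mem_map_cyl {i : Fin α} {X : A} :
    w ∈ φ ((PolyadicOp.cyl i).eval ![X]) ↔ ∃ a, Function.update w i a ∈ φ X := by
  rw [map_eval]; exact mem_setCyl (X := φ X)

theorem mem_map_transp {i j : Fin α} {X : A} :
    w ∈ φ ((PolyadicOp.transp i j).eval ![X]) ↔ w ∘ Equiv.swap i j ∈ φ X := by
  rw [map_eval]; exact mem_setTransp (X := φ X)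

/-- The difference `X - Y` of two elements of a polyadic-type algebra. -/
def polyadicDiff (α : ℕ) {A : Type*} [(polyadicLanguage α).Structure A] (X Y : A) : A :=
  (PolyadicOp.compl : PolyadicOp α 1).eval
    ![(PolyadicOp.join : PolyadicOp α 2).eval
      ![(PolyadicOp.compl : PolyadicOp α 1).eval ![X], Y] ]

theorem mem_map_compl {X : A} :
    w ∈ φ ((PolyadicOp.compl : PolyadicOp α 1).eval ![X]) ↔ w ∉ φ X := by
  rw [map_eval]; rfl

theorem mem_map_join {X Y : A} :
    w ∈ φ ((PolyadicOp.join : PolyadicOp α 2).eval ![X, Y]) ↔ w ∈ φ X ∨ w ∈ φ Y := by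
  rw [map_eval]; rfl

theorem mem_map_polyadicDiff {X Y : A} : w ∈ φ (polyadicDiff α X Y) ↔ w ∈ φ X ∧ w ∉ φ Y := by
  rw [polyadicDiff, mem_map_compl, mem_map_join, mem_map_compl]; tauto

theorem mem_map_congr {X : A} {J : Set (Fin α)}
    (hX : ∀ i ∉ J, (PolyadicOp.cyl i).eval ![X] = X) (hw : ∀ i ∈ J, w i = w' i) :
    w ∈ φ X ↔ w' ∈ φ X := by
  classical
  have hupdate {i : Fin α} (hi : i ∉ J) (u : Fin α → W) (a : W) :
      Function.update u i a ∈ φ X ↔ u ∈ φ X := by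
    rw [← hX i hi, mem_map_cyl, mem_map_cyl]
    simp only [Function.update_idem]
  have hpiecewise (s : Finset (Fin α)) : s.piecewise w' w ∈ φ X ↔ w ∈ φ X := by
    induction s using Finset.induction_on with
    | empty => simp
    | insert i s his ih =>
      rw [Finset.piecewise_insert]
      by_cases hi : i ∈ J
      · rwa [← hw i hi, ← Finset.piecewise_eq_of_notMem s w' w his, Function.update_eq_self]
      · rw [hupdate hi, ih]
  simpa using (hpiecewise Finset.univ).symm

end Homomorphisms

namespace ColouredSets

variable {α : ℕ} {U C W : Type*} {A : (polyadicLanguage α).Substructure (ColouredSets α U C)}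
  (φ : A →[polyadicLanguage α] Set (Fin α → W)) {w : Fin α → W}

theorem mem_polyadicDiff {X Y : A} {c : C} {s : Fin α → U} :
    s ∈ (polyadicDiff α X Y).1 c ↔ s ∈ X.1 c ∧ s ∉ Y.1 c := by
  change ¬ (¬ s ∈ X.1 c ∨ s ∈ Y.1 c) ↔ _
  tauto

theorem polyadicDiff_self {X : A} (hX : ∀ c, X.1 c = ∅) : polyadicDiff α X X = X :=
  Subtype.ext (funext fun c => Set.ext fun s => by simp [mem_polyadicDiff, hX])

theorem nonempty_of_mem_map {X : A} (hw : w ∈ φ X) : ∃ c, (X.1 c).Nonempty := by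
  by_contra! h
  rw [← polyadicDiff_self h, mem_map_polyadicDiff] at hw
  exact hw.2 hw.1

theorem map_nonempty (hφ : Function.Injective φ) {X : A} {c : C} (hX : (X.1 c).Nonempty) :
    (φ X).Nonempty := by
  by_contra! h
  have hdiff : φ (polyadicDiff α X X) = φ X := Set.ext fun w => by
    simp [mem_map_polyadicDiff, h]
  obtain ⟨s, hs⟩ := hX
  have : s ∈ (polyadicDiff α X X).1 c := by rwa [hφ hdiff]
  exact (mem_polyadicDiff.1 this).2 hs

theorem exists_mem_of_mem_map {F : Set A} (hF : F.Finite) {Z : A} (hZ : w ∈ φ Z) :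
    ∃ c, ∃ s ∈ Z.1 c, ∀ X ∈ F, s ∈ X.1 c ↔ w ∈ φ X := by
  induction F, hF using Set.Finite.induction_on generalizing Z with
  | empty =>
    obtain ⟨c, s, hs⟩ := nonempty_of_mem_map φ hZ
    exact ⟨c, s, hs, by simp⟩
  | @insert X F _ _ ih =>
    by_cases hX : w ∈ φ X
    · obtain ⟨c, s, hs, h⟩ := ih ((mem_map_polyadicDiff φ (X := Z) (Y := polyadicDiff α Z X)).2
        ⟨hZ, fun h => ((mem_map_polyadicDiff φ).1 h).2 hX⟩)
      simp only [mem_polyadicDiff] at hs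
      exact ⟨c, s, hs.1, Set.forall_mem_insert.2 ⟨by tauto, h⟩⟩
    · obtain ⟨c, s, hs, h⟩ := ih ((mem_map_polyadicDiff φ).2 ⟨hZ, hX⟩)
      rw [mem_polyadicDiff] at hs
      exact ⟨c, s, hs.1, Set.forall_mem_insert.2 ⟨iff_of_false hs.2 hX, h⟩⟩

end ColouredSets

section Elements

variable {α : ℕ} {V : Type} {C : Type*} {p q r : Fin α}

namespace ColouredSets

/-- The member of a split algebra that consists of the same invariant set in every colour. -/
def constFamily {U G : Type*} [Group G] [MulAction G U] {Q : Set (Fin α → U)}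
    {hQ : ∀ (i j : Fin α) (s : Fin α → U), s ∘ Equiv.swap i j ∈ Q → s ∈ Q} (Y : Set (Fin α → U))
    (hY : ∀ (g : G) s, s ∈ Y → g • s ∈ Y) : splitAlgebra C G Q hQ :=
  ⟨fun _ => Y, fun _ => hY, fun _ _ _ _ => id⟩

theorem eval_cyl_constFamily {U G : Type*} [Group G] [MulAction G U] {Q : Set (Fin α → U)}
    {hQ : ∀ (i j : Fin α) (s : Fin α → U), s ∘ Equiv.swap i j ∈ Q → s ∈ Q} {Y : Set (Fin α → U)}
    {hY : ∀ (g : G) s, s ∈ Y → g • s ∈ Y} {i : Fin α}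
    (hi : ∀ s a, Function.update s i a ∈ Y ↔ s ∈ Y) :
    (PolyadicOp.cyl i).eval ![(constFamily Y hY : splitAlgebra C G Q hQ)] = constFamily Y hY := by
  refine Subtype.ext (funext fun c => Set.ext fun s => mem_eval_cyl.trans ⟨?_, fun hs =>
    ⟨s i, c, (hi s (s i)).2 hs⟩⟩)
  rintro ⟨a, _, ha⟩
  exact (hi s a).1 ha

theorem eval_transp_eq {U : Type*} {A : (polyadicLanguage α).Substructure (ColouredSets α U C)}
    {X Y : A} (h : ∀ c s, s ∘ Equiv.swap p q ∈ X.1 c ↔ s ∈ Y.1 c) :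
    (PolyadicOp.transp p q).eval ![X] = Y :=
  Subtype.ext (funext fun c => Set.ext fun s => mem_eval_transp.trans (h c s))

end ColouredSets

/-- The sequences with a point of the given sort at `p`. -/
def kindAt (C : Type*) (V : Type) (p : Fin α) (k : Kind) : edgeAlgebra α V C :=
  ColouredSets.constFamily {s | (s p).kind = k} fun g s => (Pt.kind_smul g (s p)).trans

/-- The sequences with a labelling at `r` and the vertex labelled by `a` at `p`. -/
def labelledAt (C : Type*) (p r : Fin α) (a : V) : edgeAlgebra α V C :=
  ColouredSets.constFamily {s | ∃ t, s r = .labelling t ∧ s p = .vertex (t a)} fun g s => by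
    rintro ⟨t, hr, hp⟩
    exact ⟨g.1 * t, congrArg (g • ·) hr, congrArg (g • ·) hp⟩

/-- The edges at `p` and `q` of colour `c`. -/
def edgeAt (V : Type) (p q : Fin α) (c : C) : edgeAlgebra α V C :=
  ⟨fun d => {s | IsEdge p q s ∧ d = c}, fun _ g _ h => ⟨h.1.smul g, h.2⟩,
    fun _ hs _ _ h => (hs ⟨p, q, h.1⟩).elim⟩

variable {W : Type*} (φ : edgeAlgebra α V C →[polyadicLanguage α] Set (Fin α → W))
  {w w' : Fin α → W}

theorem mem_map_kindAt_congr {k : Kind} (hw : w p = w' p) :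
    w ∈ φ (kindAt C V p k) ↔ w' ∈ φ (kindAt C V p k) :=
  mem_map_congr φ (J := {p})
    (fun i hi => ColouredSets.eval_cyl_constFamily fun s a => by
      change (Function.update s i a p).kind = k ↔ (s p).kind = k
      rw [Function.update_of_ne (Ne.symm hi)])
    (by simpa using hw)

theorem mem_map_labelledAt_congr {a : V} (hp : w p = w' p) (hr : w r = w' r) :
    w ∈ φ (labelledAt C p r a) ↔ w' ∈ φ (labelledAt C p r a) :=
  mem_map_congr φ (J := {p, r})
    (fun i hi => ColouredSets.eval_cyl_constFamily fun s b => by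
      simp only [Set.mem_insert_iff, Set.mem_singleton_iff, not_or] at hi
      simp only [Set.mem_ofPred_eq, Function.update_of_ne (Ne.symm hi.1),
        Function.update_of_ne (Ne.symm hi.2)])
    (by simp [hp, hr])

theorem eval_transp_labelledAt (hp : r ≠ p) (hq : r ≠ q) {a : V} :
    (PolyadicOp.transp p q).eval ![labelledAt C p r a] = labelledAt C q r a :=
  ColouredSets.eval_transp_eq fun _ s => by
    change (∃ t, s (Equiv.swap p q r) = .labelling t ∧ s (Equiv.swap p q p) = .vertex (t a)) ↔
      ∃ t, s r = .labelling t ∧ s q = .vertex (t a)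
    rw [Equiv.swap_apply_left, Equiv.swap_apply_of_ne_of_ne hp hq]

theorem eval_transp_edgeAt {c : C} :
    (PolyadicOp.transp p q).eval ![edgeAt V p q c] = edgeAt V p q c :=
  ColouredSets.eval_transp_eq fun _ s => and_congr_left'
    ⟨fun h => by
      convert h.comp_swap using 1
      funext l
      simp, IsEdge.comp_swap⟩

theorem mem_map_labelledAt_swap (hp : r ≠ p) (hq : r ≠ q) {a : V} :
    w ∈ φ (labelledAt C q r a) ↔ w ∘ Equiv.swap p q ∈ φ (labelledAt C p r a) := by
  rw [← eval_transp_labelledAt hp hq, mem_map_transp]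

theorem mem_map_edgeAt_swap {c : C} :
    w ∘ Equiv.swap p q ∈ φ (edgeAt V p q c) ↔ w ∈ φ (edgeAt V p q c) := by
  rw [← mem_map_transp, eval_transp_edgeAt]

end Elements

section Labellings

variable {α : ℕ} {V : Type} {C W : Type*} {p q r : Fin α}
  (φ : edgeAlgebra α V C →[polyadicLanguage α] Set (Fin α → W)) {w : Fin α → W}

theorem exists_mem_map_labelledAt [Finite V] (hr : w ∈ φ (kindAt C V r .labelling))
    (hp : w ∈ φ (kindAt C V p .vertex)) : ∃ a, w ∈ φ (labelledAt C p r a) := by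
  obtain ⟨c, s, hs, h⟩ := ColouredSets.exists_mem_of_mem_map φ
    ((Set.finite_range (labelledAt C p r)).insert (kindAt C V r .labelling)) hp
  obtain ⟨t, ht⟩ := Pt.kind_eq_labelling.1 ((h _ (Set.mem_insert _ _)).2 hr)
  obtain ⟨b, hb⟩ := Pt.kind_eq_vertex.1 hs
  refine ⟨t.symm b, (h _ (Set.mem_insert_of_mem _ (Set.mem_range_self _))).1 ⟨t, ht, ?_⟩⟩
  rw [hb, Equiv.apply_symm_apply]

theorem eq_of_mem_map_labelledAt {a : V} (hp : w ∈ φ (labelledAt C p r a))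
    (hq : w ∈ φ (labelledAt C q r a)) : w p = w q := by
  obtain ⟨c, s, ⟨t, hr, hsp⟩, h⟩ := ColouredSets.exists_mem_of_mem_map φ
    (Set.toFinite {labelledAt C q r a, (PolyadicOp.diag p q).eval ![]}) hp
  obtain ⟨t', hr', hsq⟩ := (h _ (Set.mem_insert _ _)).2 hq
  have htt' : t = t' := Pt.labelling.inj (hr.symm.trans hr')
  have hs : s p = s q := by rw [hsp, hsq, htt']
  exact (mem_map_diag φ).1 ((h _ (Set.mem_insert_of_mem _ rfl)).1 hs)

/-- The points of a representation that occur as vertices at position `p`. -/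
def vertices (p : Fin α) : Set W := {x | ∃ w ∈ φ (kindAt C V p .vertex), w p = x}

theorem mem_vertices : w p ∈ vertices φ p ↔ w ∈ φ (kindAt C V p .vertex) :=
  ⟨fun ⟨_, hw', h⟩ => (mem_map_kindAt_congr φ h).1 hw', fun hw => ⟨w, hw, rfl⟩⟩

theorem update_mem_map_vertex {x : W} :
    Function.update w p x ∈ φ (kindAt C V p .vertex) ↔ x ∈ vertices φ p := by
  rw [← mem_vertices, Function.update_self]

-- A labelling in the representation assigns different names in `V` to different vertices.
theorem exists_injective_vertices [Finite V] (hpq : p ≠ q) (hp : r ≠ p) (hq : r ≠ q)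
    (hw : w ∈ φ (kindAt C V r .labelling)) :
    ∃ f : vertices φ p → V, Function.Injective f := by
  have hlabel (x : vertices φ p) : ∃ a, Function.update w p x ∈ φ (labelledAt C p r a) :=
    exists_mem_map_labelledAt φ
      ((mem_map_kindAt_congr φ (Function.update_of_ne hp _ _)).2 hw)
      ((update_mem_map_vertex φ).2 x.2)
  choose f hf using hlabel
  refine ⟨f, fun x y hxy => Subtype.ext ?_⟩
  let u := Function.update (Function.update w p x) q y
  have hx : u ∈ φ (labelledAt C p r (f x)) := by
    refine (mem_map_labelledAt_congr φ ?_ ?_).1 (hf x) <;> simp [u, hpq, hq]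
  have hy : u ∈ φ (labelledAt C q r (f x)) := by
    refine (mem_map_labelledAt_swap φ hp hq).2
      ((mem_map_labelledAt_congr φ ?_ ?_).1 (hxy ▸ hf y)) <;>
      simp [u, hp, hq, Equiv.swap_apply_of_ne_of_ne hp hq]
  simpa [u, hpq] using eq_of_mem_map_labelledAt φ hx hy

end Labellings

section EdgeGraph

variable {α : ℕ} {V : Type} {C W : Type*} {p q : Fin α}
  (φ : edgeAlgebra α V C →[polyadicLanguage α] Set (Fin α → W)) {w : Fin α → W} {c c' : C}

theorem ne_of_mem_map_edgeAt (h : w ∈ φ (edgeAt V p q c)) : w p ≠ w q := by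
  intro hw
  obtain ⟨d, s, hs, hF⟩ := ColouredSets.exists_mem_of_mem_map φ
    (Set.finite_singleton ((PolyadicOp.diag p q).eval ![])) h
  have hs' : s p = s q := (hF _ rfl).2 ((mem_map_diag φ).2 hw)
  exact hs.1.ne (hs.1.injective hs')

theorem eq_of_mem_map_edgeAt (h : w ∈ φ (edgeAt V p q c)) (h' : w ∈ φ (edgeAt V p q c')) :
    c = c' := by
  obtain ⟨d, s, hs, hF⟩ :=
    ColouredSets.exists_mem_of_mem_map φ (Set.finite_singleton (edgeAt V p q c')) h
  exact hs.2.symm.trans ((hF _ rfl).2 h').2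

theorem mem_vertices_of_mem_map_edgeAt (h : w ∈ φ (edgeAt V p q c)) : w p ∈ vertices φ p := by
  obtain ⟨d, s, hs, hF⟩ :=
    ColouredSets.exists_mem_of_mem_map φ (Set.finite_singleton (kindAt C V p .vertex)) h
  exact (mem_vertices φ).2 ((hF _ rfl).1 hs.1.kind_left)

theorem exists_update_mem_map_edgeAt [Nontrivial V] (hw : w ∈ φ (edgeAt V p q c)) (c' : C) {x : W}
    (hx : x ∈ vertices φ p) :
    ∃ y, Function.update (Function.update w p x) q y ∈ φ (edgeAt V p q c') := by
  let extend (c : C) := (PolyadicOp.cyl q).eval ![edgeAt V p q c]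
  obtain ⟨d, s, hs, hF⟩ := ColouredSets.exists_mem_of_mem_map φ
    (Set.toFinite {(PolyadicOp.cyl p).eval ![extend c], extend c'})
    ((update_mem_map_vertex φ (w := w)).2 hx)
  have hw' : Function.update w p x ∈ φ ((PolyadicOp.cyl p).eval ![extend c]) :=
    (mem_map_cyl φ).2 ⟨w p, (mem_map_cyl φ).2 ⟨w q, by simpa using hw⟩⟩
  obtain ⟨a, d', ha⟩ := ColouredSets.mem_eval_cyl.1 ((hF _ (Set.mem_insert _ _)).2 hw')
  obtain ⟨b, d'', hb⟩ := ColouredSets.mem_eval_cyl.1 ha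
  obtain ⟨z, hz⟩ := IsEdge.exists_update_right hs hb.1
  have hs' : s ∈ (extend c').1 d := ColouredSets.mem_eval_cyl.2 ⟨z, c', hz, rfl⟩
  exact (mem_map_cyl φ).1 ((hF _ (Set.mem_insert_of_mem _ rfl)).1 hs')

theorem update_update_comp_swap (hpq : p ≠ q) {x y : W} :
    Function.update (Function.update w p x) q y ∘ Equiv.swap p q =
      Function.update (Function.update w p y) q x := by
  simp only [Function.update_comp_equiv, Equiv.symm_swap, Equiv.swap_apply_left,
    Equiv.swap_apply_right]
  funext l
  grind

/-- The graph of the edges of colour `c` that a representation induces on its vertices when the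
coordinates of `w` other than `p` and `q` are kept fixed. -/
def edgeGraph (w : Fin α → W) (hpq : p ≠ q) (c : C) : SimpleGraph (vertices φ p) where
  Adj x y := Function.update (Function.update w p x.1) q y.1 ∈ φ (edgeAt V p q c)
  symm := ⟨fun x y h => by
    rwa [← mem_map_edgeAt_swap, update_update_comp_swap hpq] at h⟩
  loopless := ⟨fun x h => ne_of_mem_map_edgeAt φ h (by simp [hpq])⟩

theorem exists_edgeGraph_adj [Nontrivial V] (hpq : p ≠ q) (hw : w ∈ φ (edgeAt V p q c)) (c' : C)
    (x : vertices φ p) : ∃ y, (edgeGraph φ w hpq c').Adj x y := by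
  obtain ⟨y, hy⟩ := exists_update_mem_map_edgeAt φ hw c' x.2
  have hy' := mem_vertices_of_mem_map_edgeAt φ ((mem_map_edgeAt_swap φ).2 hy)
  exact ⟨⟨y, by simpa using hy'⟩, hy⟩

end EdgeGraph

theorem not_isoToPse_edgeAlgebra {α : ℕ} (hα : 3 ≤ α) {V : Type} [Fintype V] [Nontrivial V]
    {C : Type*} [Fintype C] [Nonempty C] (hcard : Fintype.card V ≤ Fintype.card C + 1)
    (heven : Even (Fintype.card C)) : ¬ IsoToPse.{_, v} α (edgeAlgebra α V C) := by
  intro hiso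
  obtain ⟨W, ⟨φ⟩⟩ := isoToPse_iff.1 hiso
  have c : C := Classical.arbitrary C
  let p : Fin α := ⟨0, by lia⟩
  let q : Fin α := ⟨1, by lia⟩
  let r : Fin α := ⟨2, by lia⟩
  have hpq : p ≠ q := by simp [p, q]
  obtain ⟨w, hw⟩ := ColouredSets.map_nonempty φ.toHom φ.injective
    (X := kindAt C V r .labelling) (c := c) ⟨fun _ => .labelling 1, rfl⟩
  obtain ⟨f, hf⟩ := exists_injective_vertices φ.toHom hpq (r := r)
    (by simp [p, r]) (by simp [q, r]) hw
  obtain ⟨s, hs⟩ := exists_isEdge (V := V) hpq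
  obtain ⟨w', hw'⟩ := ColouredSets.map_nonempty φ.toHom φ.injective
    (X := edgeAt V p q c) (c := c) ⟨s, hs, rfl⟩
  have : Nonempty (vertices φ.toHom p) := ⟨⟨_, mem_vertices_of_mem_map_edgeAt φ.toHom hw'⟩⟩
  have := Fintype.ofInjective f hf
  exact Nat.not_even_iff_odd.2 (odd_card_of_factorization (G := edgeGraph φ.toHom w' hpq)
    (fun _ _ _ _ => eq_of_mem_map_edgeAt φ.toHom) (exists_edgeGraph_adj φ.toHom hpq hw')
    ((Fintype.card_le_of_injective f hf).trans hcard)) heven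

theorem exists_even_map_zmod (k : ℕ) [NeZero k] : ∃ f : ZMod (2 * k + 1) → ZMod k,
    (∀ d, f (-d) = f d) ∧ ∀ c, ∃ d ≠ 0, f d = c := by
  refine ⟨fun d => (d.valMinAbs.natAbs : ℕ),
    fun d => congrArg Nat.cast (ZMod.natAbs_valMinAbs_neg d), fun c => ?_⟩
  obtain ⟨j, hj0, hjk, hj⟩ : ∃ j : ℕ, j ≠ 0 ∧ j ≤ k ∧ (j : ZMod k) = c := by
    by_cases hc : c = 0
    · exact ⟨k, NeZero.ne k, le_rfl, by simp [hc]⟩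
    · exact ⟨c.val, (ZMod.val_ne_zero c).2 hc, c.val_le, ZMod.natCast_zmod_val c⟩
  have habs : (j : ZMod (2 * k + 1)).valMinAbs = j :=
    ZMod.valMinAbs_natCast_of_le_half (by lia)
  refine ⟨j, fun h => hj0 ?_, by simpa [habs] using hj⟩
  rwa [← ZMod.valMinAbs_eq_zero, habs, Nat.cast_eq_zero] at h

theorem theorem3 (α n : ℕ) (hα : 3 ≤ α) :
    ∃ (A : Type u) (_ : (polyadicLanguage α).Structure A),
      ¬ IsoToPse.{u, v} α A ∧
      (∀ S : (polyadicLanguage α).Substructure A, IsNGenerated n S → IsoToPse.{u, v} α S) ∧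
      ReductIsoToSubPse.{u, v} α (cylFreeOps α) A ∧
      ReductIsoToSubPse.{u, v} α (diagFreeOps α) A ∧
      ReductIsoToSubPse.{u, v} α (transpFreeOps α) A := by
  let k := 2 ^ (α * α * n)
  have hk : 0 < k := by positivity
  have : NeZero k := ⟨hk.ne'⟩
  let V := ZMod (2 * k + 1)
  let C := ULift.{u} (ZMod (2 * k))
  have : Nontrivial V := ZMod.nontrivial_iff.2 (by lia)
  have hV : Fintype.card V = 2 * k + 1 := ZMod.card _
  have hC : Fintype.card C = 2 * k := by rw [Fintype.card_ulift, ZMod.card]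
  obtain ⟨f, hf⟩ := exists_map_onto_ne_zero_of_card_lt V C (by lia)
  obtain ⟨g, hneg, hg⟩ := exists_even_map_zmod k
  refine ⟨edgeAlgebra α V C, inferInstance, ?_, ?_, ?_, ?_, ?_⟩
  · exact not_isoToPse_edgeAlgebra hα (by lia) (by simp [hC])
  · exact fun S hS => hS.isoToPse (Nat.card_zmod k).ge (isoToPse_edgeAlgebra hα hg hneg)
  · exact cylFreeReduct_edgeAlgebra hα
  · exact diagFreeReduct_edgeAlgebra hα
  · exact transpFreeReduct_edgeAlgebra hα hf
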